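/- Let $\xi$ be a transcendental real number. For $n\ge 1$ let $\widehat\lambda_n(\xi)$ be the supremum of the real $\lambda$ such that for all sufficiently large $X$ the system $$1\le x\le X,\qquad \max_{1\le j\le n}|\xi^j x-y_j|\le X^{-\lambda}$$ has a solution in integers $x,y_1,\dots,y_n$, and let $\widehat w_n(\xi)$ be the supremum (in $[-\infty,\infty]$) of the real $w$ such that for all sufficiently large $X$ the system $$1\le \max_{1\le j\le n}|a_j|\le X,\qquad |a_0+a_1\xi+\cdots+a_n\xi^n|\le X^{-w}$$ has a solution in integers $a_0,\dots,a_n$. Put $$\overline{\widehat w}(\xi)=\limsup_{n\to\infty}\frac{\widehat w_n(\xi)}{n},\quad \underline{\widehat w}(\xi)=\liminf_{n\to\infty}\frac{\widehat w_n(\xi)}{n},\quad \overline{\widehat\lambda}(\xi)=\limsup_{n\to\infty} n\widehat\lambda_n(\xi),\quad \underline{\widehat\lambda}(\xi)=\liminf_{n\to\infty} n\widehat\lambda_n(\xi).$$ For $t\in[1,2]$ let $$R(t)=\frac{t-\sqrt{2t-t^2}}{2t},\qquad S(t)=\frac{1-2R(t)}{1-(t+1)R(t)+tR(t)^2}\quad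 (1\le t<2),\qquad S(2)=2,$$ where $S(2)$ is the limit of the quotient as $t\to 2^-$ (at $t=2$ the quotient itself is $0/0$). Then $\overline{\widehat\lambda}(\xi)$ and $\underline{\widehat\lambda}(\xi)$ lie in $[1,2]$, and $$\overline{\widehat w}(\xi)\ \ge\ S\bigl(\overline{\widehat\lambda}(\xi)\bigr),\qquad \underline{\widehat w}(\xi)\ \ge\ S\bigl(\underline{\widehat\lambda}(\xi)\bigr).$$ Moreover $S$ is strictly increasing on $[1,2]$ and maps $[1,2]$ bijectively onto itself. -/

import Mathlib

open Filter

noncomputable section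

namespace DiophExp

/-- The pair of conditions `1 ≤ x ≤ X` and `max_{1 ≤ j ≤ n} |ξ ^ j x - y_j| ≤ X ^ (-lam)` has a
solution in integers `x, y_1, …, y_n` (here `y j` stands for `y_{j+1}`). -/
def SimulSolvable (n : ℕ) (ξ lam X : ℝ) : Prop :=
  ∃ (x : ℤ) (y : Fin n → ℤ), 1 ≤ x ∧ (x : ℝ) ≤ X ∧
    ∀ j : Fin n, |ξ ^ ((j : ℕ) + 1) * (x : ℝ) - (y j : ℝ)| ≤ X ^ (-lam)

/-- The pair of conditions `1 ≤ max_{1 ≤ j ≤ n} |a_j| ≤ X` and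
`|a_0 + a_1 ξ + ⋯ + a_n ξ ^ n| ≤ X ^ (-w)` has a solution in integers `a_0, …, a_n`. -/
def LinFormSolvable (n : ℕ) (ξ w X : ℝ) : Prop :=
  ∃ a : Fin (n + 1) → ℤ,
    (∃ j : Fin n, 1 ≤ |a j.succ|) ∧ (∀ j : Fin n, |(a j.succ : ℝ)| ≤ X) ∧
      |∑ i : Fin (n + 1), (a i : ℝ) * ξ ^ (i : ℕ)| ≤ X ^ (-w)

/-- The uniform exponent of simultaneous approximation to `ξ, ξ ^ 2, …, ξ ^ n`: the supremum, in
the extended reals, of the real `lam` such that the system is solvable for all large real `X`. -/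
def hatLambda (n : ℕ) (ξ : ℝ) : EReal :=
  sSup (Real.toEReal '' {lam : ℝ | ∀ᶠ X : ℝ in atTop, SimulSolvable n ξ lam X})

/-- The uniform linear form exponent: the supremum, in the extended reals, of the real `w` such
that the system is solvable for all large real `X`. -/
def hatW (n : ℕ) (ξ : ℝ) : EReal :=
  sSup (Real.toEReal '' {w : ℝ | ∀ᶠ X : ℝ in atTop, LinFormSolvable n ξ w X})

def upperHatLambda (ξ : ℝ) : EReal :=
  limsup (fun n : ℕ => (n : EReal) * hatLambda n ξ) atTop

def lowerHatLambda (ξ : ℝ) : EReal :=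
  liminf (fun n : ℕ => (n : EReal) * hatLambda n ξ) atTop

def upperHatW (ξ : ℝ) : EReal :=
  limsup (fun n : ℕ => hatW n ξ / (n : EReal)) atTop

def lowerHatW (ξ : ℝ) : EReal :=
  liminf (fun n : ℕ => hatW n ξ / (n : EReal)) atTop

def R (t : ℝ) : ℝ := (t - √(2 * t - t ^ 2)) / (2 * t)

/-- The function `S` on `[1, 2]`. At `t = 2` the quotient has the form `0 / 0` and `S` takes the
value `2`, which is the limit of the quotient for `t → 2` from the left. -/
def S (t : ℝ) : ℝ :=
  if t = 2 then 2 else (1 - 2 * R t) / (1 - (t + 1) * R t + t * R t ^ 2)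

end DiophExp

end

/-!
Let `m + r = n` and suppose that `λ > 1 / m` is admissible for simultaneous approximation to
`ξ, …, ξ ^ n`. Let `q` run through the best denominators, let `x_i` be the nearest integer to
`ξ ^ i q`, and consider the windows `(x_j, …, x_{j + m})`, `0 ≤ j ≤ r`. A linear relation between
them is a polynomial of degree at most `r` that annihilates, with its first `m` shifts, the sequence
`x_i`. Minkowski's theorem provides an integer polynomial of degree at most `m` that annihilates the
sequences of both `q` and the next denominator, and through greatest common divisors with it every
annihilator for the next denominator is one for `q`. So the spaces of annihilators decrease, hence
stabilise, and as `ξ` is transcendental they stabilise at `0`: the windows are eventually linearly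
independent. A linear form in `1, ξ, …, ξ ^ m` that is small at `ξ` is small on all `r + 1` windows,
and applying Minkowski's theorem to the vectors orthogonal to the windows gives forms smaller than
Dirichlet's. The ratio `m / n = 1 - R t` makes the gain largest.
-/

namespace DiophExp

open Matrix MeasureTheory Polynomial

section GeometryOfNumbers

variable {ι κ : Type*} [Fintype ι]

theorem exists_map_intCast_mul_eq_one [Finite κ] [DecidableEq κ]
    {V : Matrix κ ι ℤ} (hV : LinearIndependent ℤ V.row) :
    ∃ B : Matrix ι κ ℝ, V.map (Int.cast : ℤ → ℝ) * B = 1 := by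
  have := Fintype.ofFinite κ
  have hgram : (V * Vᵀ).det ≠ 0 := fun h0 ↦ by
    obtain ⟨v, hv0, hv⟩ := exists_vecMul_eq_zero_iff.2 h0
    have hself : v ᵥ* V ⬝ᵥ v ᵥ* V = 0 := by
      have : v ᵥ* (V * Vᵀ) ⬝ᵥ v = 0 := by rw [hv, zero_dotProduct]
      rwa [← vecMul_vecMul, ← dotProduct_mulVec, mulVec_transpose] at this
    exact hv0 (vecMul_injective_iff.2 hV
      ((dotProduct_self_eq_zero.1 hself).trans (zero_vecMul V).symm))
  set W : Matrix κ ι ℝ := V.map Int.cast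
  have hmap : W * Wᵀ = (V * Vᵀ).map (Int.castRingHom ℝ) := by
    rw [Matrix.map_mul, transpose_map]
    rfl
  have hunit : IsUnit (W * Wᵀ).det := by
    rw [hmap, ← RingHom.mapMatrix_apply, ← RingHom.map_det, isUnit_iff_ne_zero]
    exact Int.cast_ne_zero.2 hgram
  exact ⟨Wᵀ * (W * Wᵀ)⁻¹, by rw [← Matrix.mul_assoc, mul_nonsing_inv _ hunit]⟩

variable [DecidableEq ι]

theorem volume_setOf_abs_mulVec_lt {A : Matrix ι ι ℝ} (hA : A.det ≠ 0) {c : ι → ℝ}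
    (hc : ∀ i, 0 < c i) :
    volume {x | ∀ i, |(A *ᵥ x) i| < c i} = ENNReal.ofReal (|A.det|⁻¹ * ∏ i, (2 * c i)) := by
  have hpre : {x | ∀ i, |(A *ᵥ x) i| < c i} =
      Matrix.toLin' A ⁻¹' Set.univ.pi fun i ↦ Set.Ioo (-c i) (c i) := by
    ext x
    simp [abs_lt]
  have hside : ∀ i, volume (Set.Ioo (-c i) (c i)) = ENNReal.ofReal (2 * c i) := fun i ↦ by
    rw [Real.volume_Ioo, sub_neg_eq_add, two_mul]
  rw [hpre, Measure.addHaar_preimage_linearMap _ (by rwa [LinearMap.det_toLin']),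
    LinearMap.det_toLin', volume_pi_pi, abs_inv, ENNReal.ofReal_mul (by positivity),
    ENNReal.ofReal_prod_of_nonneg fun i _ ↦ (mul_pos two_pos (hc i)).le]
  simp only [hside]

/-- **Minkowski's theorem on linear forms.** -/
theorem exists_int_forall_abs_mulVec_lt (A : Matrix ι ι ℝ) (hA : A.det ≠ 0) {c : ι → ℝ}
    (hc : ∀ i, 0 < c i) (h : |A.det| < ∏ i, c i) :
    ∃ p : ι → ℤ, p ≠ 0 ∧ ∀ i, |(A *ᵥ fun j ↦ (p j : ℝ)) i| < c i := by
  set s : Set (ι → ℝ) := {x | ∀ i, |(A *ᵥ x) i| < c i}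
  have hsymm : ∀ x ∈ s, -x ∈ s := fun x hx i ↦ by simpa [mulVec_neg] using hx i
  have hconv : Convex ℝ s := by
    have := (convex_pi (s := Set.univ) fun i _ ↦ convex_Ioo (-c i) (c i)).linear_preimage
      (Matrix.toLin' A)
    convert! this using 1
    ext x
    simp [s, abs_lt]
  have hvol : volume (ZSpan.fundamentalDomain (Pi.basisFun ℝ ι)) * 2 ^ Module.finrank ℝ (ι → ℝ) <
      volume s := by
    have hdet := abs_pos.2 hA
    have hprod : 0 < ∏ i, c i := Finset.prod_pos fun i _ ↦ hc i
    rw [volume_setOf_abs_mulVec_lt hA hc, ZSpan.fundamentalDomain_pi_basisFun, volume_pi_pi]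
    simp only [Real.volume_Ico, sub_zero, ENNReal.ofReal_one, Finset.prod_const_one, one_mul,
      Module.finrank_fintype_fun_eq_card, Finset.prod_mul_distrib, Finset.prod_const,
      Finset.card_univ]
    rw [← ENNReal.ofReal_ofNat, ← ENNReal.ofReal_pow zero_le_two,
      ENNReal.ofReal_lt_ofReal_iff (by positivity), mul_left_comm,
      lt_mul_iff_one_lt_right (by positivity), inv_mul_eq_div, one_lt_div hdet]
    exact h
  have : Countable (Submodule.span ℤ (Set.range (Pi.basisFun ℝ ι))).toAddSubgroup :=
    inferInstanceAs (Countable (Submodule.span ℤ (Set.range (Pi.basisFun ℝ ι))))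
  obtain ⟨⟨x, hx⟩, hx0, hxs⟩ := exists_ne_zero_mem_lattice_of_measure_mul_two_pow_lt_measure
    (ZSpan.isAddFundamentalDomain' (Pi.basisFun ℝ ι) volume) hsymm hconv hvol
  have hint : ∀ i, ∃ z : ℤ, (z : ℝ) = x i := by
    simpa using ((Pi.basisFun ℝ ι).mem_span_iff_repr_mem ℤ x).1 hx
  choose p hp using hint
  obtain rfl : (fun j ↦ (p j : ℝ)) = x := funext hp
  refine ⟨p, ?_, hxs⟩
  rintro rfl
  exact hx0 (by ext; simp)

/-- The box `|A x| < c` is stretched by `1 / d` in the directions of the rows of `V`. An integer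
point `p` of the stretched box comes from a point `y` of the original one with `V y = d • V p`, so
that `|V p| < 1`, hence `V p = 0`, and then `p = y`. -/
theorem exists_int_mulVec_eq_zero [Fintype κ] (A : Matrix ι ι ℝ) (hA : A.det ≠ 0)
    {c : ι → ℝ} (hc : ∀ i, 0 < c i) {V : Matrix κ ι ℤ}
    (hV : LinearIndependent ℤ V.row) {d : κ → ℝ} (hd : ∀ k, 0 < d k)
    (hdet : |A.det| * ∏ k, d k < ∏ i, c i)
    (hbox : ∀ x : ι → ℝ, (∀ i, |(A *ᵥ x) i| < c i) →
      ∀ k, |(V.map (Int.cast : ℤ → ℝ) *ᵥ x) k| < d k) :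
    ∃ p : ι → ℤ, p ≠ 0 ∧ V *ᵥ p = 0 ∧ ∀ i, |(A *ᵥ fun j ↦ (p j : ℝ)) i| < c i := by
  classical
  obtain ⟨B, hB⟩ := exists_map_intCast_mul_eq_one hV
  set W : Matrix κ ι ℝ := V.map Int.cast with hW
  set M : Matrix ι ι ℝ := 1 + B * (diagonal d - 1) * W with hM
  have hMdet : M.det = ∏ k, d k := by
    rw [hM, det_one_add_mul_comm, ← Matrix.mul_assoc, hB, Matrix.one_mul, add_sub_cancel,
      det_diagonal]
  have hWM : W * M = diagonal d * W := by
    rw [hM, Matrix.mul_add, Matrix.mul_one, ← Matrix.mul_assoc, ← Matrix.mul_assoc, hB,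
      Matrix.one_mul, Matrix.sub_mul, Matrix.one_mul, add_sub_cancel]
  have hdpos : 0 < ∏ k, d k := Finset.prod_pos fun k _ ↦ hd k
  obtain ⟨p, hp0, hp⟩ := exists_int_forall_abs_mulVec_lt (A * M)
    (by rw [det_mul, hMdet]; exact mul_ne_zero hA hdpos.ne') hc
    (by rwa [det_mul, hMdet, abs_mul, abs_of_pos hdpos])
  set x : ι → ℝ := fun j ↦ (p j : ℝ) with hx
  simp only [← mulVec_mulVec] at hp
  have hWx : W *ᵥ x = fun k ↦ ((V *ᵥ p) k : ℝ) := by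
    ext k
    simp [hW, hx, mulVec, dotProduct]
  have hVp : V *ᵥ p = 0 := by
    ext k
    have hk := hbox _ hp k
    rw [mulVec_mulVec, hWM, ← mulVec_mulVec, mulVec_diagonal, abs_mul, abs_of_pos (hd k),
      mul_lt_iff_lt_one_right (hd k), hWx] at hk
    have hk' : |((V *ᵥ p) k : ℝ)| < 1 := hk
    exact Int.abs_lt_one_iff.1 (by exact_mod_cast hk')
  have hMx : M *ᵥ x = x := by
    rw [hM, add_mulVec, one_mulVec, ← mulVec_mulVec, hWx, hVp]
    simp [← Pi.zero_def]
  exact ⟨p, hp0, hVp, by rwa [hMx] at hp⟩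

end GeometryOfNumbers

section LinearForms

variable {m : ℕ} {ξ : ℝ}

/-- The box of real coefficient vectors `x` for which the polynomial `∑ x_i X ^ i` is smaller than
`δ` at `ξ` and has all coefficients but the constant one smaller than `H`. -/
def linFormBox (m : ℕ) (ξ δ H : ℝ) : Set (Fin (m + 1) → ℝ) :=
  {x | |∑ i, x i * ξ ^ (i : ℕ)| < δ ∧ ∀ j : Fin m, |x j.succ| < H}

/-- The matrix of the linear forms `x ↦ ∑ x_i ξ ^ i` and `x ↦ x_i`, `i ≥ 1`, that cut out
`linFormBox`. -/
def formMatrix (m : ℕ) (ξ : ℝ) : Matrix (Fin (m + 1)) (Fin (m + 1)) ℝ :=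
  Matrix.of (Fin.cons (fun k ↦ ξ ^ (k : ℕ)) fun j ↦ Pi.single j.succ 1)

theorem abs_formMatrix_mulVec_lt_iff {δ H : ℝ} {x : Fin (m + 1) → ℝ} :
    (∀ i, |(formMatrix m ξ *ᵥ x) i| < (Fin.cons δ fun _ ↦ H : Fin (m + 1) → ℝ) i) ↔
      x ∈ linFormBox m ξ δ H := by
  simp [Fin.forall_fin_succ, formMatrix, linFormBox, mulVec, dotProduct, mul_comm,
    Pi.single_apply]

theorem det_formMatrix (m : ℕ) (ξ : ℝ) : (formMatrix m ξ).det = 1 := by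
  rw [det_of_isUpperTriangular, Fin.prod_univ_succ]
  · simp [formMatrix]
  · intro i k hki
    cases i using Fin.cases with
    | zero => exact absurd hki (Fin.not_lt_zero k)
    | succ j => exact Pi.single_eq_of_ne (ne_of_lt hki) 1

theorem exists_int_mem_linFormBox (m : ℕ) (ξ : ℝ) {δ H : ℝ} (hδ : 0 < δ) (hH : 0 < H)
    (h : 1 < δ * H ^ m) :
    ∃ p : Fin (m + 1) → ℤ, p ≠ 0 ∧ (fun i ↦ (p i : ℝ)) ∈ linFormBox m ξ δ H := by
  simp_rw [← abs_formMatrix_mulVec_lt_iff]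
  exact exists_int_forall_abs_mulVec_lt _ (by simp [det_formMatrix])
    (Fin.forall_fin_succ.2 ⟨hδ, fun _ ↦ hH⟩) (by simpa [det_formMatrix, Fin.prod_univ_succ])

theorem exists_int_mem_linFormBox_mulVec_eq_zero {k : ℕ} {δ H d : ℝ} (hδ : 0 < δ) (hH : 0 < H)
    (hd : 0 < d) {V : Matrix (Fin k) (Fin (m + 1)) ℤ} (hV : LinearIndependent ℤ V.row)
    (h : d ^ k < δ * H ^ m)
    (hbox : ∀ x ∈ linFormBox m ξ δ H, ∀ i, |(V.map (Int.cast : ℤ → ℝ) *ᵥ x) i| < d) :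
    ∃ p : Fin (m + 1) → ℤ, p ≠ 0 ∧ V *ᵥ p = 0 ∧ (fun i ↦ (p i : ℝ)) ∈ linFormBox m ξ δ H := by
  simp_rw [← abs_formMatrix_mulVec_lt_iff] at hbox ⊢
  exact exists_int_mulVec_eq_zero _ (by simp [det_formMatrix])
    (Fin.forall_fin_succ.2 ⟨hδ, fun _ ↦ hH⟩) hV (fun _ ↦ hd)
    (by simpa [det_formMatrix, Fin.prod_univ_succ]) hbox

theorem linFormSolvable_of_mem_linFormBox {w X : ℝ} (hw : 0 ≤ w) (hX : 1 ≤ X)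
    {p : Fin (m + 1) → ℤ} (hp : p ≠ 0) (hbox : (fun i ↦ (p i : ℝ)) ∈ linFormBox m ξ (X ^ (-w)) X) :
    LinFormSolvable m ξ w X := by
  refine ⟨p, ?_, fun j ↦ (hbox.2 j).le, hbox.1.le⟩
  by_contra! hlt
  have hsucc : ∀ j : Fin m, p j.succ = 0 := fun j ↦ Int.abs_lt_one_iff.1 (hlt j)
  have hzero : p 0 = 0 := by
    have h := hbox.1.trans_le (Real.rpow_le_one_of_one_le_of_nonpos hX (neg_nonpos.2 hw))
    simp only [Fin.sum_univ_succ, hsucc, Fin.val_zero, pow_zero, mul_one, Int.cast_zero, zero_mul,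
      Finset.sum_const_zero, add_zero] at h
    exact Int.abs_lt_one_iff.1 (by exact_mod_cast h)
  exact hp (funext (Fin.forall_fin_succ.2 ⟨hzero, hsucc⟩))

theorem eventually_linFormSolvable_of_lt (ξ : ℝ) {w : ℝ} (hw : 0 ≤ w) (hwm : w < m) :
    ∀ᶠ X : ℝ in atTop, LinFormSolvable m ξ w X := by
  filter_upwards [eventually_gt_atTop 1] with X hX
  have hX0 := zero_lt_one.trans hX
  have hvol : 1 < X ^ (-w) * X ^ m := by
    rw [← Real.rpow_natCast, ← Real.rpow_add hX0]
    exact Real.one_lt_rpow hX (by linarith)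
  obtain ⟨p, hp, hbox⟩ := exists_int_mem_linFormBox m ξ (Real.rpow_pos_of_pos hX0 _) hX0 hvol
  exact linFormSolvable_of_mem_linFormBox hw hX.le hp hbox

end LinearForms

section SimultaneousApproximation

variable {n : ℕ} {ξ : ℝ}

/-- The matrix of the linear forms `x ↦ x_0` and `x ↦ ξ ^ i x_0 - x_i`, `i ≥ 1`, that govern
simultaneous approximation to the powers of `ξ`. -/
def simulMatrix (n : ℕ) (ξ : ℝ) : Matrix (Fin (n + 1)) (Fin (n + 1)) ℝ :=
  Matrix.of (Fin.cons (Pi.single 0 1) fun j ↦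
    ξ ^ ((j : ℕ) + 1) • Pi.single 0 1 - Pi.single j.succ 1)

theorem simulMatrix_mulVec (x : Fin (n + 1) → ℝ) :
    simulMatrix n ξ *ᵥ x =
      Fin.cons (x 0) fun j : Fin n ↦ ξ ^ ((j : ℕ) + 1) * x 0 - x j.succ := by
  ext i
  cases i using Fin.cases with
  | zero => simp [simulMatrix, mulVec]
  | succ j =>
    change (ξ ^ ((j : ℕ) + 1) • Pi.single 0 1 - Pi.single j.succ 1) ⬝ᵥ x = _
    simp [sub_dotProduct]

theorem abs_det_simulMatrix (n : ℕ) (ξ : ℝ) : |(simulMatrix n ξ).det| = 1 := by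
  rw [det_of_isLowerTriangular, Fin.prod_univ_succ]
  · simp [simulMatrix, abs_pow]
  · intro i k hik
    have hik : i < k := hik
    have hk : k ≠ 0 := (Fin.zero_le i |>.trans_lt hik).ne'
    cases i using Fin.cases with
    | zero => simp [simulMatrix, hk]
    | succ j => simp [simulMatrix, hk, hik.ne']

theorem simulSolvable_of_forall_abs_lt {lam X : ℝ} (hlam : 0 ≤ lam) (hX : 1 ≤ X)
    {p : Fin (n + 1) → ℤ} (hp : p ≠ 0) (h0 : |(p 0 : ℝ)| ≤ X)
    (h : ∀ j : Fin n, |ξ ^ ((j : ℕ) + 1) * (p 0 : ℝ) - p j.succ| < X ^ (-lam)) :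
    SimulSolvable n ξ lam X := by
  have hp0 : p 0 ≠ 0 := fun hp0 ↦ hp <| funext <| Fin.forall_fin_succ.2 ⟨hp0, fun j ↦ by
    have hj := (h j).trans_le (Real.rpow_le_one_of_one_le_of_nonpos hX (neg_nonpos.2 hlam))
    rw [hp0, Int.cast_zero, mul_zero, zero_sub, abs_neg] at hj
    exact Int.abs_lt_one_iff.1 (by exact_mod_cast hj)⟩
  wlog hpos : 0 < p 0 generalizing p
  · refine this (p := -p) (by simpa) (by simpa) (fun j ↦ ?_) (by simpa) (by simp; omega)
    rw [← abs_neg]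
    convert h j using 2
    simp
    ring
  exact ⟨p 0, fun j ↦ p j.succ, hpos, (le_abs_self _).trans h0, fun j ↦ (h j).le⟩

theorem eventually_simulSolvable_of_lt (ξ : ℝ) {lam : ℝ} (h0 : 0 ≤ lam) (hlam : lam * n < 1) :
    ∀ᶠ X : ℝ in atTop, SimulSolvable n ξ lam X := by
  filter_upwards [eventually_gt_atTop 1] with X hX
  have hX0 := zero_lt_one.trans hX
  have hvol : 1 < X * (X ^ (-lam)) ^ n := by
    rw [← Real.rpow_natCast, ← Real.rpow_mul hX0.le, ← Real.rpow_one_add' hX0.le (by linarith)]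
    exact Real.one_lt_rpow hX (by linarith)
  obtain ⟨p, hp, hlt⟩ := exists_int_forall_abs_mulVec_lt (simulMatrix n ξ)
    (c := Fin.cons X fun _ ↦ X ^ (-lam)) (abs_pos.1 (by simp [abs_det_simulMatrix]))
    (Fin.forall_fin_succ.2 ⟨hX0, fun _ ↦ Real.rpow_pos_of_pos hX0 _⟩)
    (by simpa [abs_det_simulMatrix, Fin.prod_univ_succ])
  simp only [simulMatrix_mulVec, Fin.forall_fin_succ, Fin.cons_zero, Fin.cons_succ] at hlt
  exact simulSolvable_of_forall_abs_lt h0 hX.le hp hlt.1.le hlt.2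

theorem SimulSolvable.mono {lam lam' X : ℝ} (hs : SimulSolvable n ξ lam X) (hX : 1 ≤ X)
    (h : lam' ≤ lam) : SimulSolvable n ξ lam' X := by
  obtain ⟨x, y, hx, hxX, hy⟩ := hs
  exact ⟨x, y, hx, hxX,
    fun j ↦ (hy j).trans (Real.rpow_le_rpow_of_exponent_le hX (neg_le_neg h))⟩

end SimultaneousApproximation

theorem eventually_const_mul_rpow_lt_rpow {a b : ℝ} (h : a < b) (C : ℝ) :
    ∀ᶠ X : ℝ in atTop, C * X ^ a < X ^ b := by
  have hlim : Tendsto (fun X : ℝ ↦ C * X ^ (a - b)) atTop (nhds 0) := by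
    simpa [neg_sub] using (tendsto_rpow_neg_atTop (sub_pos.2 h)).const_mul C
  filter_upwards [hlim.eventually_lt_const one_pos, eventually_gt_atTop 0] with X hX hX0
  rwa [Real.rpow_sub hX0, ← mul_div_assoc, div_lt_one (Real.rpow_pos_of_pos hX0 b)] at hX

theorem abs_pow_le_max_one_pow (ξ : ℝ) {j n : ℕ} (h : j ≤ n) : |ξ| ^ j ≤ max 1 |ξ| ^ n :=
  (pow_le_pow_left₀ (abs_nonneg _) (le_max_right _ _) _).trans
    (pow_le_pow_right₀ (le_max_left _ _) h)

section RunningArgmin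

variable {α : Type*} [LinearOrder α] {f : ℕ → α}

/-- The first point at which `f` attains its minimum over `1, …, N`; the junk value at `N = 0`
is `1`. -/
def runningArgmin (f : ℕ → α) : ℕ → ℕ
  | 0 => 1
  | N + 1 => if f (N + 1) < f (runningArgmin f N) then N + 1 else runningArgmin f N

theorem one_le_runningArgmin (f : ℕ → α) (N : ℕ) : 1 ≤ runningArgmin f N := by
  induction N with
  | zero => exact le_rfl
  | succ N ih => grind [runningArgmin]

theorem runningArgmin_le {N : ℕ} (hN : 1 ≤ N) : runningArgmin f N ≤ N := by
  induction N, hN using Nat.le_induction with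
  | base => simp [runningArgmin]
  | succ N _ ih => grind [runningArgmin]

theorem apply_runningArgmin_le {N q : ℕ} (hq : 1 ≤ q) (hqN : q ≤ N) :
    f (runningArgmin f N) ≤ f q := by
  induction N with
  | zero => omega
  | succ N ih => grind [runningArgmin]

end RunningArgmin

section Denominators

variable {n : ℕ} {ξ : ℝ}

/-- The nearest integer to `ξ ^ i q`. -/
noncomputable def apx (ξ : ℝ) (q i : ℕ) : ℤ := round (ξ ^ i * q)

/-- The distance `max_{1 ≤ i ≤ n} ‖ξ ^ i q‖` of `q (ξ, …, ξ ^ n)` to the integer lattice. -/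
noncomputable def err (n : ℕ) (ξ : ℝ) (q : ℕ) : ℝ :=
  ‖fun j : Fin n ↦ ξ ^ ((j : ℕ) + 1) * q - apx ξ q (j + 1)‖

theorem err_nonneg (n : ℕ) (ξ : ℝ) (q : ℕ) : 0 ≤ err n ξ q := norm_nonneg _

theorem abs_sub_apx_le (ξ : ℝ) (q : ℕ) {i : ℕ} (hi : i ≤ n) :
    |ξ ^ i * q - apx ξ q i| ≤ err n ξ q := by
  cases i with
  | zero => simpa [apx] using err_nonneg n ξ q
  | succ i =>
    exact norm_le_pi_norm (fun j : Fin n ↦ ξ ^ ((j : ℕ) + 1) * q - apx ξ q (j + 1)) ⟨i, hi⟩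

theorem SimulSolvable.err_runningArgmin_le {lam X : ℝ} (h : SimulSolvable n ξ lam X) {N : ℕ}
    (hN : X < N + 1) : err n ξ (runningArgmin (err n ξ) N) ≤ X ^ (-lam) := by
  obtain ⟨x, y, hx, hxX, hy⟩ := h
  lift x to ℕ using by omega
  simp only [Int.cast_natCast] at hxX hy
  have hxN : x ≤ N := Nat.lt_succ_iff.1 (by exact_mod_cast hxX.trans_lt hN)
  have herr : err n ξ x ≤ X ^ (-lam) :=
    (pi_norm_le_iff_of_nonneg (Real.rpow_nonneg ((Nat.cast_nonneg x).trans hxX) _)).2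
      fun j ↦ (round_le _ _).trans (hy j)
  exact (apply_runningArgmin_le (by omega) hxN).trans herr

end Denominators

section EvalApx

variable {n : ℕ}

/-- The linear functional on polynomials that sends `X ^ i` to the nearest integer to
`ξ ^ i q`, an approximation of `P ↦ q P(ξ)`. -/
noncomputable def evalApx (ξ : ℝ) (q : ℕ) : ℚ[X] →ₗ[ℚ] ℚ :=
  Polynomial.lsum fun i ↦ (apx ξ q i : ℚ) • LinearMap.id

theorem evalApx_eq_sum (ξ : ℝ) (q : ℕ) {P : ℚ[X]} {d : ℕ} (hd : P.natDegree ≤ d) :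
    evalApx ξ q P = ∑ i ∈ Finset.range (d + 1), P.coeff i * apx ξ q i := by
  rw [evalApx, Polynomial.lsum_apply, Polynomial.sum_over_range' _ (by simp) (d + 1) (by omega)]
  simp [mul_comm]

theorem exists_int_evalApx (ξ : ℝ) (q : ℕ) (P : ℤ[X]) :
    ∃ z : ℤ, evalApx ξ q (P.map (Int.castRingHom ℚ)) = z := by
  refine ⟨∑ i ∈ Finset.range (P.natDegree + 1), P.coeff i * apx ξ q i, ?_⟩
  rw [evalApx_eq_sum ξ q natDegree_map_le]
  simp

theorem abs_evalApx_sub_le (ξ : ℝ) (q : ℕ) {P : ℚ[X]} (hP : P.natDegree ≤ n) {B : ℝ}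
    (hB : ∀ i, |(P.coeff i : ℝ)| ≤ B) :
    |(evalApx ξ q P : ℝ) - q * aeval ξ P| ≤ (n + 1) * (B * err n ξ q) := by
  have hsum : (evalApx ξ q P : ℝ) - q * aeval ξ P =
      ∑ i ∈ Finset.range (n + 1), -(P.coeff i * (ξ ^ i * q - apx ξ q i)) := by
    rw [evalApx_eq_sum ξ q hP, aeval_eq_sum_range' (Nat.lt_succ_of_le hP), Finset.mul_sum]
    push_cast
    rw [← Finset.sum_sub_distrib]
    refine Finset.sum_congr rfl fun i _ ↦ ?_
    rw [Rat.smul_def]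
    ring
  have hterm : ∀ i ∈ Finset.range (n + 1),
      |-(P.coeff i * (ξ ^ i * q - apx ξ q i))| ≤ B * err n ξ q := fun i hi ↦ by
    rw [abs_neg, abs_mul]
    exact mul_le_mul (hB i) (abs_sub_apx_le ξ q (Finset.mem_range_succ_iff.1 hi)) (abs_nonneg _)
      ((abs_nonneg _).trans (hB i))
  rw [hsum]
  exact (Finset.abs_sum_le_sum_abs _ _).trans ((Finset.sum_le_card_nsmul _ _ _ hterm).trans
    (by simp))

theorem abs_evalApx_mul_X_pow_le (ξ : ℝ) (q : ℕ) {P : ℚ[X]} {j : ℕ}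
    (hP : P.natDegree + j ≤ n) {B : ℝ} (hB : ∀ i, |(P.coeff i : ℝ)| ≤ B) :
    |(evalApx ξ q (P * X ^ j) : ℝ)| ≤
      max 1 |ξ| ^ n * (q * |aeval ξ P|) + (n + 1) * (B * err n ξ q) := by
  have hcoeff : ∀ i, |((P * X ^ j).coeff i : ℝ)| ≤ B := fun i ↦ by
    rw [coeff_mul_X_pow']
    split_ifs
    · exact hB _
    · simpa using (abs_nonneg _).trans (hB 0)
  have happrox := abs_evalApx_sub_le ξ q (natDegree_mul_le.trans (by simpa using hP)) hcoeff
  have hmain : |(q : ℝ) * aeval ξ (P * X ^ j)| ≤ max 1 |ξ| ^ n * (q * |aeval ξ P|) := by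
    rw [map_mul, map_pow, aeval_X, ← mul_assoc, abs_mul, abs_mul, abs_pow, Nat.abs_cast, mul_comm]
    gcongr
    exact abs_pow_le_max_one_pow ξ ((Nat.le_add_left _ _).trans hP)
  linarith [abs_sub_abs_le_abs_sub (evalApx ξ q (P * X ^ j) : ℝ) (q * aeval ξ (P * X ^ j))]

end EvalApx

theorem map_mul_eq_zero_of_forall_X_pow {R M : Type*} [CommRing R] [AddCommGroup M] [Module R M]
    {φ : R[X] →ₗ[R] M} {P : R[X]} {r : ℕ} (h : ∀ j ≤ r, φ (P * X ^ j) = 0) {A : R[X]}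
    (hA : A.natDegree ≤ r) : φ (P * A) = 0 := by
  rw [A.as_sum_range' (r + 1) (Nat.lt_succ_of_le hA), Finset.mul_sum, map_sum]
  refine Finset.sum_eq_zero fun i hi ↦ ?_
  rw [← C_mul_X_pow_eq_monomial, mul_left_comm, ← smul_eq_C_mul, map_smul,
    h i (Finset.mem_range_succ_iff.1 hi), smul_zero]

theorem exists_gcd_eq_mul_add_mul_natDegree_le {K : Type*} [Field K] (P : K[X]) {Q : K[X]}
    (hQ : Q ≠ 0) :
    ∃ G A B : K[X], G = P * A + Q * B ∧ G ∣ P ∧ G ∣ Q ∧ A.natDegree ≤ Q.natDegree ∧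
      B.natDegree ≤ P.natDegree := by
  classical
  set G := EuclideanDomain.gcd P Q
  set A := EuclideanDomain.gcdA P Q
  set B := EuclideanDomain.gcdB P Q + P * (A / Q)
  have hG : G = P * (A % Q) + Q * B := by
    have hmod : Q * (A / Q) + A % Q = A := EuclideanDomain.div_add_mod A Q
    have hgcd : G = P * A + Q * EuclideanDomain.gcdB P Q := EuclideanDomain.gcd_eq_gcd_ab P Q
    grind
  have hGQ : G ∣ Q := EuclideanDomain.gcd_dvd_right P Q
  have hA : (A % Q).natDegree ≤ Q.natDegree :=
    natDegree_le_natDegree (EuclideanDomain.mod_lt A hQ).le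
  refine ⟨G, A % Q, B, hG, EuclideanDomain.gcd_dvd_left P Q, hGQ, hA, ?_⟩
  obtain hB | hB := eq_or_ne B 0
  · simp [hB]
  have hQB : (Q * B).natDegree ≤ P.natDegree + Q.natDegree := by
    rw [← sub_eq_of_eq_add' hG]
    exact (natDegree_sub_le _ _).trans (max_le
      ((natDegree_le_of_dvd hGQ hQ).trans (Nat.le_add_left _ _))
      (natDegree_mul_le.trans (by gcongr)))
  rw [natDegree_mul hQ hB] at hQB
  omega

theorem exists_isPrimitive_map_eq_smul {G : ℚ[X]} (hG : G ≠ 0) :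
    ∃ F : ℤ[X], F.IsPrimitive ∧ ∃ c : ℚ, c ≠ 0 ∧ F.map (Int.castRingHom ℚ) = c • G := by
  obtain ⟨b, hb, hbG⟩ := IsLocalization.integerNormalization_spec (nonZeroDivisors ℤ) G
  set F := IsLocalization.integerNormalization (nonZeroDivisors ℤ) G
  have hb0 : (b : ℚ) ≠ 0 := Int.cast_ne_zero.2 (nonZeroDivisors.ne_zero hb)
  have hFG : F.map (Int.castRingHom ℚ) = (b : ℚ) • G := by
    rw [Int.cast_smul_eq_zsmul]
    exact hbG
  have hF0 : F ≠ 0 := fun h ↦ smul_ne_zero hb0 hG (by rw [← hFG, h, Polynomial.map_zero])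
  have hc0 : (F.content : ℚ) ≠ 0 := Int.cast_ne_zero.2 (content_eq_zero_iff.not.2 hF0)
  have hcont : F.map (Int.castRingHom ℚ) =
      (F.content : ℚ) • F.primPart.map (Int.castRingHom ℚ) := by
    conv_lhs => rw [F.eq_C_content_mul_primPart]
    rw [Polynomial.map_mul, map_C, smul_eq_C_mul, eq_intCast]
  refine ⟨F.primPart, F.isPrimitive_primPart, (F.content : ℚ)⁻¹ * b,
    mul_ne_zero (inv_ne_zero hc0) hb0, ?_⟩
  rw [mul_smul, ← hFG, hcont, inv_smul_smul₀ hc0]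

theorem abs_coeff_le_of_dvd {G P : ℤ[X]} (h : G ∣ P) (hP0 : P ≠ 0) {m : ℕ} (hm : P.natDegree ≤ m)
    {B : ℝ} (hB : ∀ i, |(P.coeff i : ℝ)| ≤ B) (i : ℕ) :
    |(G.coeff i : ℝ)| ≤ 2 ^ m * ((m + 1) * B) := by
  obtain ⟨F, rfl⟩ := h
  have hF0 : F ≠ 0 := right_ne_zero_of_mul hP0
  set ι := Int.castRingHom ℂ
  have hmahler : ((G.map ι) * (F.map ι)).mahlerMeasure ≤ (m + 1) * B := by
    have hdeg : ((G * F).map ι).natDegree < m + 1 :=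
      Nat.lt_succ_of_le (natDegree_map_le.trans hm)
    rw [← Polynomial.map_mul]
    refine (mahlerMeasure_le_sum_norm_coeff _).trans ?_
    rw [Polynomial.sum_over_range' _ (by simp) (m + 1) hdeg]
    refine (Finset.sum_le_card_nsmul _ _ B fun i _ ↦ ?_).trans (by simp)
    rw [coeff_map]
    simpa [ι] using hB i
  have hchoose : ((G.map ι).natDegree.choose i : ℝ) ≤ 2 ^ m := by
    have hdeg : (G.map ι).natDegree ≤ m :=
      natDegree_map_le.trans ((natDegree_le_of_dvd (dvd_mul_right _ _) hP0).trans hm)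
    exact_mod_cast (Nat.choose_le_two_pow _ _).trans (Nat.pow_le_pow_right two_pos hdeg)
  calc |(G.coeff i : ℝ)| = ‖(G.map ι).coeff i‖ := by simp [ι]
    _ ≤ _ := norm_coeff_le_choose_mul_mahlerMeasure_of_one_le_mahlerMeasure i
        (G.map ι) (F.map ι) (one_le_mahlerMeasure_of_ne_zero hF0)
    _ ≤ _ := mul_le_mul hchoose hmahler (mahlerMeasure_nonneg _) (by positivity)

section CommonAnnihilators

variable {m n r : ℕ} {ξ : ℝ}

theorem abs_coord_le_of_mem_linFormBox {δ H : ℝ} (hδ : δ ≤ H) {x : Fin (m + 1) → ℝ}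
    (hx : x ∈ linFormBox m ξ δ H) (i : Fin (m + 1)) :
    |x i| ≤ (1 + m * max 1 |ξ| ^ m) * H := by
  obtain ⟨hsum, hsucc⟩ := hx
  have hH : 0 < H := (abs_nonneg _).trans_lt (hsum.trans_le hδ)
  cases i using Fin.cases with
  | succ j =>
    refine (hsucc j).le.trans (le_mul_of_one_le_left hH.le (le_add_of_nonneg_right ?_))
    positivity
  | zero =>
    have htail : |∑ j : Fin m, x j.succ * ξ ^ ((j : ℕ) + 1)| ≤ m * (H * max 1 |ξ| ^ m) := by
      refine (Finset.abs_sum_le_sum_abs _ _).trans ?_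
      refine (Finset.sum_le_card_nsmul _ _ (H * max 1 |ξ| ^ m) fun j _ ↦ ?_).trans (by simp)
      rw [abs_mul, abs_pow]
      exact mul_le_mul (hsucc j).le (abs_pow_le_max_one_pow ξ j.2) (by positivity) hH.le
    simp only [Fin.sum_univ_succ, Fin.val_zero, pow_zero, mul_one, Fin.val_succ] at hsum
    have htri := abs_sub (x 0 + ∑ j : Fin m, x j.succ * ξ ^ ((j : ℕ) + 1))
      (∑ j : Fin m, x j.succ * ξ ^ ((j : ℕ) + 1))
    rw [add_sub_cancel_right] at htri
    linarith

theorem exists_int_poly_abs_aeval_lt (m : ℕ) (ξ : ℝ) {δ H : ℝ} (hδ : 0 < δ) (hδH : δ ≤ H)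
    (h : 1 < δ * H ^ m) :
    ∃ P : ℤ[X], P ≠ 0 ∧ P.natDegree ≤ m ∧ |aeval ξ P| < δ ∧
      ∀ i, |(P.coeff i : ℝ)| ≤ (1 + m * max 1 |ξ| ^ m) * H := by
  have hH := hδ.trans_le hδH
  obtain ⟨p, hp, hbox⟩ := exists_int_mem_linFormBox m ξ hδ hH h
  have hcoeff : ∀ i : Fin (m + 1), (ofFn (m + 1) p).coeff i = p i := fun i ↦
    ofFn_coeff_eq_val_of_lt _ i.2
  have hdeg : (ofFn (m + 1) p).natDegree ≤ m :=
    Nat.le_of_lt_succ (ofFn_natDegree_lt (Nat.succ_le_succ m.zero_le) p)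
  refine ⟨ofFn (m + 1) p, fun h0 ↦ hp (funext fun i ↦ ?_), hdeg, ?_, fun i ↦ ?_⟩
  · rw [← hcoeff i, h0, coeff_zero, Pi.zero_apply]
  · rw [aeval_eq_sum_range' (Nat.lt_succ_of_le hdeg), Finset.sum_range]
    simpa [hcoeff] using hbox.1
  · rcases Nat.lt_or_ge i (m + 1) with hi | hi
    · rw [hcoeff ⟨i, hi⟩]
      exact abs_coord_le_of_mem_linFormBox hδH hbox ⟨i, hi⟩
    · rw [coeff_eq_zero_of_natDegree_lt (by omega), Int.cast_zero, abs_zero]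
      positivity

theorem aeval_map_intCastRingHom (ξ : ℝ) (P : ℤ[X]) :
    aeval ξ (P.map (Int.castRingHom ℚ)) = aeval ξ P :=
  aeval_map_algebraMap ℚ ξ P

theorem evalApx_mul_X_pow_eq_zero_of_lt_one {q j : ℕ} {P : ℤ[X]} (hP : P.natDegree + j ≤ n) {B : ℝ}
    (hB : ∀ i, |(P.coeff i : ℝ)| ≤ B)
    (h : max 1 |ξ| ^ n * (q * |aeval ξ P|) + (n + 1) * (B * err n ξ q) < 1) :
    evalApx ξ q (P.map (Int.castRingHom ℚ) * X ^ j) = 0 := by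
  have hbound := abs_evalApx_mul_X_pow_le ξ q (P := P.map (Int.castRingHom ℚ)) (j := j)
    ((Nat.add_le_add_right natDegree_map_le j).trans hP) (fun i ↦ by simpa using hB i)
  rw [aeval_map_intCastRingHom] at hbound
  obtain ⟨z, hz⟩ := exists_int_evalApx ξ q (P * X ^ j)
  rw [Polynomial.map_mul, Polynomial.map_pow, map_X] at hz
  have hlt := hbound.trans_lt h
  rw [hz] at hlt ⊢
  rw [Int.abs_lt_one_iff.1 (by exact_mod_cast hlt : |z| < 1), Int.cast_zero]

theorem eventually_exists_annihilator (r : ℕ) (ξ : ℝ) {lam : ℝ} (hlam : 1 < lam * m) {ε : ℝ}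
    (hε : 0 < ε) : ∀ᶠ Y : ℝ in atTop, ∃ P : ℤ[X], P ≠ 0 ∧ P.natDegree ≤ m ∧
      (∀ i, |(P.coeff i : ℝ)| ≤ ε * Y ^ lam) ∧
      ∀ q : ℕ, q ≤ 2 * Y → err (m + r) ξ q ≤ Y ^ (-lam) →
        ∀ j ≤ r, evalApx ξ q (P.map (Int.castRingHom ℚ) * X ^ j) = 0 := by
  have hm : (0 : ℝ) < m := Nat.cast_pos.2 (Nat.pos_of_ne_zero fun h ↦ by norm_num [h] at hlam)
  obtain ⟨σ, hmσ, hσ⟩ := exists_between ((div_lt_iff₀ hm).2 hlam)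
  have hσ0 : 0 < σ := (by positivity : (0 : ℝ) < 1 / m).trans hmσ
  obtain ⟨ρ, hρ, hρσ⟩ := exists_between ((div_lt_iff₀ hm).1 hmσ)
  set D : ℝ := 1 + m * max 1 |ξ| ^ m
  set Ξ : ℝ := max 1 |ξ| ^ (m + r)
  filter_upwards [eventually_gt_atTop 1, eventually_const_mul_rpow_lt_rpow hσ (ε⁻¹ * D),
    eventually_const_mul_rpow_lt_rpow hσ (2 * ((m + r : ℕ) + 1) * D),
    eventually_const_mul_rpow_lt_rpow (sub_neg.2 hρ) (4 * Ξ)] with Y hY hcoeff hdiff hmain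
  have hY0 := zero_lt_one.trans hY
  have hvol : 1 < Y ^ (-ρ) * (Y ^ σ) ^ m := by
    rw [← Real.rpow_natCast, ← Real.rpow_mul hY0.le, ← Real.rpow_add hY0]
    exact Real.one_lt_rpow hY (by linarith)
  obtain ⟨P, hP0, hPdeg, hPξ, hPc⟩ := exists_int_poly_abs_aeval_lt m ξ
    (Real.rpow_pos_of_pos hY0 (-ρ)) (Real.rpow_le_rpow_of_exponent_le hY.le (by linarith)) hvol
  refine ⟨P, hP0, hPdeg, fun i ↦ (hPc i).trans ?_, fun q hq herr j hj ↦ ?_⟩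
  · rw [mul_assoc, inv_mul_lt_iff₀ hε] at hcoeff
    exact hcoeff.le
  · refine evalApx_mul_X_pow_eq_zero_of_lt_one (add_le_add hPdeg hj) hPc ?_
    have hfst : Ξ * (q * |aeval ξ P|) < 1 / 2 := by
      have : Ξ * (q * |aeval ξ P|) ≤ Ξ * (2 * Y * Y ^ (-ρ)) := by gcongr
      rw [Real.rpow_zero, sub_eq_add_neg, Real.rpow_one_add' hY0.le (by linarith)] at hmain
      linarith
    have hsnd : ((m + r : ℕ) + 1 : ℝ) * (D * Y ^ σ * err (m + r) ξ q) < 1 / 2 := by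
      have : ((m + r : ℕ) + 1 : ℝ) * (D * Y ^ σ * err (m + r) ξ q) ≤
          ((m + r : ℕ) + 1 : ℝ) * (D * Y ^ σ * Y ^ (-lam)) := by gcongr
      rw [← div_lt_one (Real.rpow_pos_of_pos hY0 lam), div_eq_mul_inv,
        ← Real.rpow_neg hY0.le] at hdiff
      linarith
    linarith

theorem evalApx_mul_X_pow_eq_zero_of_evalApx_eq_zero {q q' i : ℕ} {G : ℤ[X]} {B e : ℝ}
    (hG : G.natDegree + i ≤ n) (hB : ∀ i, |(G.coeff i : ℝ)| ≤ B) (hq : q ≤ q')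
    (he : err n ξ q ≤ e) (he' : err n ξ q' ≤ e)
    (hsmall : (max 1 |ξ| ^ n + 1) * ((n + 1) * (B * e)) < 1)
    (h : evalApx ξ q' (G.map (Int.castRingHom ℚ)) = 0) :
    evalApx ξ q (G.map (Int.castRingHom ℚ) * X ^ i) = 0 := by
  have hB0 : 0 ≤ B := (abs_nonneg _).trans (hB 0)
  have hGξ : q * |aeval ξ G| ≤ (n + 1) * (B * e) := by
    have happrox := abs_evalApx_sub_le (n := n) ξ q' (P := G.map (Int.castRingHom ℚ)) (B := B)
      (natDegree_map_le.trans ((Nat.le_add_right _ _).trans hG)) (fun i ↦ by simpa using hB i)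
    rw [h, aeval_map_intCastRingHom, Rat.cast_zero, zero_sub, abs_neg, abs_mul,
      Nat.abs_cast] at happrox
    calc (q : ℝ) * |aeval ξ G| ≤ q' * |aeval ξ G| := by gcongr
      _ ≤ (n + 1) * (B * err n ξ q') := happrox
      _ ≤ (n + 1) * (B * e) := by gcongr
  refine evalApx_mul_X_pow_eq_zero_of_lt_one hG hB (lt_of_le_of_lt ?_ hsmall)
  rw [add_one_mul (max 1 |ξ| ^ n)]
  gcongr

/-- The greatest common divisor `G` of `P` and `Q` is annihilated along with them, and it has small
coefficients because it divides `P`; hence its multiples, `Q` among them, stay annihilated when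
`q'` is lowered to `q`. -/
theorem evalApx_mul_X_pow_eq_zero_of_le {q q' : ℕ} {P : ℤ[X]} {B e : ℝ} (hP0 : P ≠ 0)
    (hPm : P.natDegree ≤ m) (hB : ∀ i, |(P.coeff i : ℝ)| ≤ B)
    (hP : ∀ j ≤ r, evalApx ξ q' (P.map (Int.castRingHom ℚ) * X ^ j) = 0) (hq : q ≤ q')
    (he : err (m + r) ξ q ≤ e) (he' : err (m + r) ξ q' ≤ e)
    (hsmall : (max 1 |ξ| ^ (m + r) + 1) *
      (((m + r : ℕ) + 1) * (2 ^ m * ((m + 1) * B) * e)) < 1)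
    {Q : ℚ[X]} (hQr : Q.natDegree ≤ r) (hQ : ∀ j ≤ m, evalApx ξ q' (Q * X ^ j) = 0) :
    ∀ j ≤ m, evalApx ξ q (Q * X ^ j) = 0 := by
  intro j hj
  obtain rfl | hQ0 := eq_or_ne Q 0
  · simp
  obtain ⟨G₀, A, C, hG₀, hG₀P, hG₀Q, hA, hC⟩ :=
    exists_gcd_eq_mul_add_mul_natDegree_le (P.map (Int.castRingHom ℚ)) hQ0
  have hann : evalApx ξ q' G₀ = 0 := by
    rw [hG₀, map_add, map_mul_eq_zero_of_forall_X_pow hP (hA.trans hQr),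
      map_mul_eq_zero_of_forall_X_pow hQ (hC.trans (natDegree_map_le.trans hPm)), add_zero]
  obtain ⟨G, hGprim, c, hc, hG⟩ := exists_isPrimitive_map_eq_smul (ne_zero_of_dvd_ne_zero hQ0 hG₀Q)
  have hdvd : ∀ F : ℚ[X], G₀ ∣ F → G.map (Int.castRingHom ℚ) ∣ F := fun F hF ↦ by
    rw [hG, smul_eq_C_mul]
    exact (IsUnit.mul_left_dvd (isUnit_C.2 hc.isUnit)).2 hF
  have hGP : G ∣ P := (IsPrimitive.Int.dvd_iff_map_cast_dvd_map_cast G P hGprim).2 (hdvd _ hG₀P)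
  have hGann : ∀ i ≤ m + r - G.natDegree,
      evalApx ξ q (G.map (Int.castRingHom ℚ) * X ^ i) = 0 := fun i hi ↦ by
    have hGm := (natDegree_le_of_dvd hGP hP0).trans hPm
    exact evalApx_mul_X_pow_eq_zero_of_evalApx_eq_zero (by omega)
      (abs_coeff_le_of_dvd hGP hP0 hPm hB) hq he he' hsmall
      (by rw [hG, map_smul, hann, smul_zero])
  obtain ⟨F, rfl⟩ := hdvd Q hG₀Q
  have hdeg := natDegree_mul (left_ne_zero_of_mul hQ0) (right_ne_zero_of_mul hQ0)
  rw [natDegree_map_eq_of_injective (RingHom.injective_int _)] at hdeg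
  rw [mul_assoc]
  refine map_mul_eq_zero_of_forall_X_pow hGann (natDegree_mul_le.trans ?_)
  rw [natDegree_X_pow]
  omega

end CommonAnnihilators

section Annihilators

variable {m n r : ℕ} {ξ : ℝ}

/-- The polynomials of degree at most `r` that satisfy, together with their multiples by
`X, …, X ^ m`, the linear recurrences of the approximation with denominator `q`: their coefficient
vectors are orthogonal to every window of length `r + 1` of `apx ξ q 0, …, apx ξ q (m + r)`. -/
noncomputable def annihilators (ξ : ℝ) (m r q : ℕ) : Submodule ℚ (degreeLT ℚ (r + 1)) where
  carrier := {Q | ∀ j ≤ m, evalApx ξ q ((Q : ℚ[X]) * X ^ j) = 0}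
  add_mem' hP hQ j hj := by
    rw [Submodule.coe_add, add_mul, map_add, hP j hj, hQ j hj, add_zero]
  zero_mem' j _ := by simp
  smul_mem' c Q hQ j hj := by
    rw [Submodule.coe_smul, smul_mul_assoc, map_smul, hQ j hj, smul_zero]

theorem natDegree_le_of_mem_degreeLT {R : Type*} [Semiring R] {Q : R[X]}
    (hQ : Q ∈ degreeLT R (r + 1)) : Q.natDegree ≤ r := by
  rw [degreeLT_succ_eq_degreeLE, mem_degreeLE] at hQ
  exact natDegree_le_of_degree_le hQ

theorem eventually_annihilators_le (r : ℕ) (ξ : ℝ) {lam : ℝ} (hlam : 1 < lam * m) :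
    ∀ᶠ Y : ℝ in atTop, ∀ q q' : ℕ, q ≤ q' → q' ≤ 2 * Y → err (m + r) ξ q ≤ Y ^ (-lam) →
      err (m + r) ξ q' ≤ Y ^ (-lam) → annihilators ξ m r q' ≤ annihilators ξ m r q := by
  set E : ℝ := (max 1 |ξ| ^ (m + r) + 1) * (((m + r : ℕ) + 1) * (2 ^ m * (m + 1)))
  have hE : 0 < E := by positivity
  filter_upwards [eventually_exists_annihilator r ξ hlam (show 0 < 1 / (2 * E) by positivity),
    eventually_gt_atTop 0] with Y hY hY0 q q' hq hq' he he' Q hQ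
  obtain ⟨P, hP0, hPm, hPc, hP⟩ := hY
  refine evalApx_mul_X_pow_eq_zero_of_le hP0 hPm hPc (hP q' hq' he') hq he he' ?_
    (natDegree_le_of_mem_degreeLT Q.2) hQ
  calc _ = E * (1 / (2 * E)) * (Y ^ lam * Y ^ (-lam)) := by ring
    _ < 1 := by
      rw [← Real.rpow_add hY0, add_neg_cancel, Real.rpow_zero]
      field_simp
      norm_num

theorem eventuallyConst_of_eventually_succ_le {α : Type*} [PartialOrder α] [WellFoundedLT α]
    {f : ℕ → α} (h : ∀ᶠ N in atTop, f (N + 1) ≤ f N) : EventuallyConst f atTop := by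
  obtain ⟨N₀, hN₀⟩ := eventually_atTop.1 h
  have hanti : Antitone fun N ↦ f (N₀ + N) :=
    antitone_nat_of_succ_le fun N ↦ hN₀ (N₀ + N) (Nat.le_add_right _ _)
  obtain ⟨k, hk⟩ := WellFoundedLT.antitone_chain_condition hanti
  refine eventuallyConst_atTop.2 ⟨N₀ + k, fun N hN ↦ ?_⟩
  obtain ⟨d, rfl⟩ := Nat.exists_eq_add_of_le hN
  rw [hk (k + d) (Nat.le_add_right _ _), Nat.add_assoc]

theorem aeval_eq_zero_of_eventually_evalApx_eq_zero {q : ℕ → ℕ} (hq : ∀ N, 1 ≤ q N)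
    (herr : Tendsto (fun N ↦ err n ξ (q N)) atTop (nhds 0)) {Q : ℚ[X]} (hQn : Q.natDegree ≤ n)
    (hQ : ∀ᶠ N in atTop, evalApx ξ (q N) Q = 0) : aeval ξ Q = 0 := by
  set B : ℝ := ∑ i ∈ Q.support, |(Q.coeff i : ℝ)|
  have hB : ∀ i, |(Q.coeff i : ℝ)| ≤ B := fun i ↦ by
    by_cases hi : i ∈ Q.support
    · exact Finset.single_le_sum (f := fun i ↦ |(Q.coeff i : ℝ)|) (fun _ _ ↦ abs_nonneg _) hi
    · rw [notMem_support_iff.1 hi, Rat.cast_zero, abs_zero]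
      positivity
  have hle : ∀ᶠ N in atTop, |aeval ξ Q| ≤ (n + 1) * (B * err n ξ (q N)) := by
    filter_upwards [hQ] with N hN
    have happrox := abs_evalApx_sub_le ξ (q N) hQn hB
    rw [hN, Rat.cast_zero, zero_sub, abs_neg, abs_mul, Nat.abs_cast] at happrox
    exact (le_mul_of_one_le_left (abs_nonneg _) (by exact_mod_cast hq N)).trans happrox
  have hlim : Tendsto (fun N ↦ (n + 1) * (B * err n ξ (q N))) atTop (nhds 0) := by
    simpa using (herr.const_mul B).const_mul ((n : ℝ) + 1)
  exact abs_nonpos_iff.1 (ge_of_tendsto hlim hle)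

theorem eventually_err_runningArgmin_le {lam : ℝ}
    (hs : ∀ᶠ X : ℝ in atTop, SimulSolvable n ξ lam X) :
    ∀ᶠ N : ℕ in atTop, err n ξ (runningArgmin (err n ξ) N) ≤ (N : ℝ) ^ (-lam) := by
  filter_upwards [tendsto_natCast_atTop_atTop.eventually hs] with N hN
  exact hN.err_runningArgmin_le (lt_add_one _)

theorem eventually_annihilators_runningArgmin_succ_le {lam : ℝ} (hlam : 1 < lam * m)
    (hs : ∀ᶠ X : ℝ in atTop, SimulSolvable (m + r) ξ lam X) :
    ∀ᶠ N in atTop, annihilators ξ m r (runningArgmin (err (m + r) ξ) (N + 1)) ≤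
      annihilators ξ m r (runningArgmin (err (m + r) ξ) N) := by
  filter_upwards [eventually_err_runningArgmin_le hs,
    tendsto_natCast_atTop_atTop.eventually (eventually_annihilators_le r ξ hlam),
    eventually_ge_atTop 1] with N herr hle hN
  rw [runningArgmin]
  split_ifs with hlt
  · refine hle _ _ ((runningArgmin_le hN).trans N.le_succ) ?_ herr (hlt.le.trans herr)
    exact_mod_cast (by omega : N + 1 ≤ 2 * N)
  · exact le_rfl

theorem eventually_annihilators_eq_bot {lam : ℝ} (hξ : Transcendental ℚ ξ) (hlam : 1 < lam * m)
    (hs : ∀ᶠ X : ℝ in atTop, SimulSolvable (m + r) ξ lam X) :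
    ∀ᶠ N in atTop, annihilators ξ m r (runningArgmin (err (m + r) ξ) N) = ⊥ := by
  have : Module.Finite ℚ (degreeLT ℚ (r + 1)) :=
    Module.Finite.equiv (degreeLTEquiv ℚ (r + 1)).symm
  have hlam0 : 0 < lam := pos_of_mul_pos_left (zero_lt_one.trans hlam) m.cast_nonneg
  have herr : Tendsto (fun N ↦ err (m + r) ξ (runningArgmin (err (m + r) ξ) N)) atTop (nhds 0) :=
    squeeze_zero' (.of_forall fun _ ↦ err_nonneg _ _ _) (eventually_err_runningArgmin_le hs)
      ((tendsto_rpow_neg_atTop hlam0).comp tendsto_natCast_atTop_atTop)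
  obtain ⟨k, hk⟩ := eventuallyConst_atTop.1 <| eventuallyConst_of_eventually_succ_le
    (f := fun N ↦ annihilators ξ m r (runningArgmin (err (m + r) ξ) N))
    (eventually_annihilators_runningArgmin_succ_le hlam hs)
  have hbot : annihilators ξ m r (runningArgmin (err (m + r) ξ) k) = ⊥ := by
    refine (Submodule.eq_bot_iff _).2 fun Q hQ ↦ ?_
    have hann : ∀ᶠ N in atTop, evalApx ξ (runningArgmin (err (m + r) ξ) N) Q = 0 := by
      filter_upwards [eventually_ge_atTop k] with N hN
      have hQN : Q ∈ annihilators ξ m r (runningArgmin (err (m + r) ξ) N) := by rwa [hk N hN]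
      simpa using hQN 0 m.zero_le
    have hroot := aeval_eq_zero_of_eventually_evalApx_eq_zero (one_le_runningArgmin _) herr
      ((natDegree_le_of_mem_degreeLT Q.2).trans (Nat.le_add_left r m)) hann
    by_contra hQ0
    exact hξ ⟨Q, fun h ↦ hQ0 (Subtype.ext h), hroot⟩
  filter_upwards [eventually_ge_atTop k] with N hN
  rw [hk N hN, hbot]

/-- The **Davenport–Schmidt bound**. -/
theorem lam_mul_le_one {lam : ℝ} (hξ : Transcendental ℚ ξ) (hmr : m ≤ r)
    (hs : ∀ᶠ X : ℝ in atTop, SimulSolvable (m + r) ξ lam X) : lam * m ≤ 1 := by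
  by_contra! hlam
  obtain ⟨N, hbot, herr, ⟨P, hP0, hPm, -, hP⟩, hN⟩ :=
    ((eventually_annihilators_eq_bot hξ hlam hs).and <|
      (eventually_err_runningArgmin_le hs).and <| (tendsto_natCast_atTop_atTop.eventually
        (eventually_exists_annihilator r ξ hlam one_pos)).and (eventually_ge_atTop 1)).exists
  have hmem : P.map (Int.castRingHom ℚ) ∈ degreeLT ℚ (r + 1) := by
    rw [degreeLT_succ_eq_degreeLE, mem_degreeLE]
    exact degree_le_of_natDegree_le (natDegree_map_le.trans (hPm.trans hmr))
  have hle : (runningArgmin (err (m + r) ξ) N : ℝ) ≤ 2 * N := by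
    exact_mod_cast (runningArgmin_le hN).trans (by omega)
  have hann : (⟨_, hmem⟩ : degreeLT ℚ (r + 1)) ∈
      annihilators ξ m r (runningArgmin (err (m + r) ξ) N) :=
    fun j hj ↦ hP _ hle herr j (hj.trans hmr)
  rw [hbot, Submodule.mem_bot, Subtype.ext_iff] at hann
  exact hP0 ((Polynomial.map_eq_zero_iff (RingHom.injective_int _)).1 hann)

end Annihilators

section Transference

variable {m r q : ℕ} {ξ : ℝ}

/-- The matrix of windows of length `m + 1` of the sequence `apx ξ q 0, …, apx ξ q (m + r)`. -/
noncomputable def windows (ξ : ℝ) (m r q : ℕ) : Matrix (Fin (r + 1)) (Fin (m + 1)) ℤ :=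
  Matrix.of fun j i ↦ apx ξ q (j + i)

theorem evalApx_ofFn_mul_X_pow (a : Fin (r + 1) → ℤ) (j : Fin (m + 1)) :
    evalApx ξ q (ofFn (r + 1) (fun i ↦ (a i : ℚ)) * X ^ (j : ℕ)) =
      (a ᵥ* windows ξ m r q) j := by
  have hdeg : (ofFn (r + 1) fun i ↦ (a i : ℚ)).natDegree < r + 1 :=
    ofFn_natDegree_lt (Nat.succ_le_succ r.zero_le) _
  rw [Polynomial.as_sum_range' _ _ hdeg, Finset.sum_mul, map_sum, Finset.sum_range]
  simp only [monomial_mul_X_pow, evalApx, lsum_apply, vecMul, dotProduct, windows, of_apply,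
    Int.cast_sum, Int.cast_mul]
  refine Finset.sum_congr rfl fun i _ ↦ ?_
  rw [sum_monomial_index _ _ (by simp), ofFn_coeff_eq_val_of_lt _ i.2]
  simp [mul_comm]

theorem linearIndependent_windows_row (h : annihilators ξ m r q = ⊥) :
    LinearIndependent ℤ (windows ξ m r q).row := by
  rw [← vecMul_injective_iff, ← coe_vecMulLinear, ← LinearMap.ker_eq_bot, LinearMap.ker_eq_bot']
  intro a ha
  have hdeg : ofFn (r + 1) (fun i ↦ (a i : ℚ)) ∈ degreeLT ℚ (r + 1) :=
    mem_degreeLT.2 (ofFn_degree_lt _)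
  have hann : (⟨_, hdeg⟩ : degreeLT ℚ (r + 1)) ∈ annihilators ξ m r q := fun j hj ↦ by
    have := evalApx_ofFn_mul_X_pow (ξ := ξ) (q := q) a ⟨j, Nat.lt_succ_of_le hj⟩
    rw [this, show a ᵥ* windows ξ m r q = 0 from ha, Pi.zero_apply, Int.cast_zero]
  rw [h, Submodule.mem_bot, Subtype.ext_iff] at hann
  ext i
  have hcoeff : (a i : ℚ) = (ofFn (r + 1) fun i ↦ (a i : ℚ)).coeff i := by
    rw [ofFn_coeff_eq_val_of_lt _ i.2]
  rw [show ofFn (r + 1) (fun i ↦ (a i : ℚ)) = 0 from hann, coeff_zero] at hcoeff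
  exact_mod_cast hcoeff

theorem abs_windows_mulVec_le {δ H : ℝ} (hδ : δ ≤ H) {x : Fin (m + 1) → ℝ}
    (hx : x ∈ linFormBox m ξ δ H) (k : Fin (r + 1)) :
    |((windows ξ m r q).map (Int.cast : ℤ → ℝ) *ᵥ x) k| ≤
      max 1 |ξ| ^ r * (q * δ) + (m + 1) * ((1 + m * max 1 |ξ| ^ m) * H * err (m + r) ξ q) := by
  have hsplit : ((windows ξ m r q).map (Int.cast : ℤ → ℝ) *ᵥ x) k =
      ξ ^ (k : ℕ) * (q * ∑ i, x i * ξ ^ (i : ℕ)) -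
        ∑ i : Fin (m + 1), x i * (ξ ^ ((k : ℕ) + i) * q - apx ξ q (k + i)) := by
    simp only [mulVec, dotProduct, windows, map_apply, of_apply, Finset.mul_sum]
    rw [← Finset.sum_sub_distrib]
    refine Finset.sum_congr rfl fun i _ ↦ ?_
    ring
  have hmain : |ξ ^ (k : ℕ) * (q * ∑ i, x i * ξ ^ (i : ℕ))| ≤ max 1 |ξ| ^ r * (q * δ) := by
    rw [abs_mul, abs_mul, abs_pow, Nat.abs_cast]
    gcongr
    exacts [abs_pow_le_max_one_pow ξ (Nat.le_of_lt_succ k.2), hx.1.le]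
  have hterm : ∀ i ∈ Finset.univ, |x i * (ξ ^ ((k : ℕ) + i) * q - apx ξ q (k + i))| ≤
      (1 + m * max 1 |ξ| ^ m) * H * err (m + r) ξ q := fun i _ ↦ by
    have hxi := abs_coord_le_of_mem_linFormBox hδ hx i
    rw [abs_mul]
    exact mul_le_mul hxi (abs_sub_apx_le ξ q (by omega)) (abs_nonneg _) ((abs_nonneg _).trans hxi)
  rw [hsplit]
  exact (abs_sub _ _).trans (add_le_add hmain ((Finset.abs_sum_le_sum_abs _ _).trans
    ((Finset.sum_le_card_nsmul _ _ _ hterm).trans (by simp))))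

theorem linFormSolvable_of_annihilators_eq_bot {w d Y : ℝ} (hw : 0 ≤ w) (hY : 1 ≤ Y)
    (hbot : annihilators ξ m r q = ⊥)
    (hd : max 1 |ξ| ^ r * (q * Y ^ (-w)) +
      (m + 1) * ((1 + m * max 1 |ξ| ^ m) * Y * err (m + r) ξ q) < d)
    (hvol : d ^ (r + 1) < Y ^ (-w) * Y ^ m) : LinFormSolvable m ξ w Y := by
  have hY0 := zero_lt_one.trans_le hY
  have hδY : Y ^ (-w) ≤ Y :=
    (Real.rpow_le_one_of_one_le_of_nonpos hY (neg_nonpos.2 hw)).trans hY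
  have hd0 : 0 < d := by
    refine lt_of_le_of_lt ?_ hd
    have := err_nonneg (m + r) ξ q
    positivity
  obtain ⟨p, hp, -, hbox⟩ := exists_int_mem_linFormBox_mulVec_eq_zero
    (Real.rpow_pos_of_pos hY0 (-w)) hY0 hd0 (linearIndependent_windows_row hbot) hvol
    fun x hx k ↦ (abs_windows_mulVec_le hδY hx k).trans_lt hd
  exact linFormSolvable_of_mem_linFormBox hw hY hp hbox

/-- Choosing `q` of size `Y ^ κ` with `κ = (w + 1) / (1 + λ)` balances the two contributions
`q Y ^ (-w)` and `q ^ (-λ) Y` to the size of the windows. -/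
theorem eventually_linFormSolvable_of_simulSolvable {lam w : ℝ} (hξ : Transcendental ℚ ξ)
    (hlam : 1 < lam * m) (hw0 : 0 ≤ w) (hw : w * (1 - lam * r) < m - r + lam * m - 1)
    (hs : ∀ᶠ X : ℝ in atTop, SimulSolvable (m + r) ξ lam X) :
    ∀ᶠ Y : ℝ in atTop, LinFormSolvable m ξ w Y := by
  have hlam0 : 0 < lam := pos_of_mul_pos_left (zero_lt_one.trans hlam) m.cast_nonneg
  obtain ⟨β, hγβ, hβ⟩ : ∃ β, (1 - lam * w) / (1 + lam) < β ∧ β < (m - w) / (r + 1) :=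
    exists_between ((div_lt_div_iff₀ (by positivity) (by positivity)).2 (by linarith))
  rw [lt_div_iff₀ (by positivity)] at hβ
  set κ : ℝ := (w + 1) / (1 + lam) with hκ
  have hκ0 : 0 < κ := by positivity
  have hκw : κ + -w = (1 - lam * w) / (1 + lam) := by rw [hκ]; field_simp; ring
  have hκlam : 1 + κ * -lam = (1 - lam * w) / (1 + lam) := by rw [hκ]; field_simp; ring
  set Ξ : ℝ := max 1 |ξ| ^ r
  set D : ℝ := 1 + m * max 1 |ξ| ^ m
  have hκtop := tendsto_rpow_atTop hκ0
  filter_upwards [eventually_gt_atTop 1, hκtop.eventually hs,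
    (tendsto_nat_floor_atTop.comp hκtop).eventually (eventually_annihilators_eq_bot hξ hlam hs),
    eventually_const_mul_rpow_lt_rpow hγβ (Ξ + (m + 1) * D)] with Y hY hsim hbot hlt
  have hY0 := zero_lt_one.trans hY
  set q := runningArgmin (err (m + r) ξ) ⌊Y ^ κ⌋₊
  have herr : err (m + r) ξ q ≤ (Y ^ κ) ^ (-lam) :=
    hsim.err_runningArgmin_le (Nat.lt_floor_add_one _)
  have hq : (q : ℝ) ≤ Y ^ κ :=
    (Nat.cast_le.2 (runningArgmin_le (Nat.one_le_floor_iff _ |>.2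
      (Real.one_le_rpow hY.le hκ0.le)))).trans (Nat.floor_le (by positivity))
  refine linFormSolvable_of_annihilators_eq_bot (q := q) (d := Y ^ β) hw0 hY.le hbot ?_ ?_
  · calc _ ≤ Ξ * (Y ^ κ * Y ^ (-w)) + (m + 1) * (D * Y * (Y ^ κ) ^ (-lam)) := by gcongr
      _ = Ξ * Y ^ (κ + -w) + (m + 1) * (D * Y ^ (1 + κ * -lam)) := by
        rw [Real.rpow_add hY0, Real.rpow_add hY0, Real.rpow_one, Real.rpow_mul hY0.le]
        ring
      _ = (Ξ + (m + 1) * D) * Y ^ ((1 - lam * w) / (1 + lam)) := by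
        rw [hκw, hκlam]
        ring
      _ < Y ^ β := hlt
  · rw [← Real.rpow_natCast, ← Real.rpow_natCast, ← Real.rpow_mul hY0.le, ← Real.rpow_add hY0]
    refine Real.rpow_lt_rpow_of_exponent_lt hY ?_
    push_cast
    linarith

end Transference

section ExtremalFunction

variable {t : ℝ}

theorem mul_R (ht : t ≠ 0) : t * R t = (t - √(2 * t - t ^ 2)) / 2 := by
  rw [R]
  field_simp

theorem mul_one_sub_R_mul_one_sub_mul_R (ht : t ∈ Set.Icc (1 : ℝ) 2) :
    2 * t * ((1 - R t) * (1 - t * R t)) = √(2 * t - t ^ 2) * (1 + √(2 * t - t ^ 2)) := by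
  have hsq : √(2 * t - t ^ 2) ^ 2 = 2 * t - t ^ 2 := Real.sq_sqrt (by nlinarith [ht.1, ht.2])
  calc 2 * t * ((1 - R t) * (1 - t * R t)) = 2 * (t - t * R t) * (1 - t * R t) := by ring
    _ = _ := by
      rw [mul_R (zero_lt_one.trans_le ht.1).ne']
      linear_combination -hsq / 2

theorem S_eq (ht : t ∈ Set.Icc (1 : ℝ) 2) : S t = 2 / (1 + √(2 * t - t ^ 2)) := by
  obtain rfl | ht2 := eq_or_ne t 2
  · norm_num [S]
  have ht0 : 0 < t := zero_lt_one.trans_le ht.1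
  have hu : 0 < √(2 * t - t ^ 2) := Real.sqrt_pos.2 (by nlinarith [lt_of_le_of_ne ht.2 ht2])
  have hR := mul_R ht0.ne'
  have hden := mul_one_sub_R_mul_one_sub_mul_R ht
  set u := √(2 * t - t ^ 2)
  have hden0 : (1 - R t) * (1 - t * R t) ≠ 0 := fun h ↦ by
    rw [h, mul_zero] at hden
    exact (by positivity : u * (1 + u) ≠ 0) hden.symm
  rw [S, if_neg ht2, show 1 - (t + 1) * R t + t * R t ^ 2 = (1 - R t) * (1 - t * R t) by ring,
    div_eq_div_iff hden0 (by positivity)]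
  refine mul_left_cancel₀ ht0.ne' ?_
  linear_combination -2 * (1 + u) * hR - hden

theorem S_mul_one_sub_R_mul_one_sub_mul_R (ht : t ∈ Set.Icc (1 : ℝ) 2) :
    S t * ((1 - R t) * (1 - t * R t)) = 1 - 2 * R t := by
  have ht0 : t ≠ 0 := (zero_lt_one.trans_le ht.1).ne'
  have hS : S t * (1 + √(2 * t - t ^ 2)) = 2 := by
    rw [S_eq ht, div_mul_cancel₀ _ (by positivity)]
  refine mul_left_cancel₀ (mul_ne_zero two_ne_zero ht0) ?_
  linear_combination S t * mul_one_sub_R_mul_one_sub_mul_R ht + √(2 * t - t ^ 2) * hS +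
    4 * mul_R ht0

theorem S_one : S 1 = 1 := by
  rw [S_eq ⟨le_rfl, one_le_two⟩]
  norm_num

theorem S_two : S 2 = 2 := if_pos rfl

theorem strictMonoOn_S : StrictMonoOn S (Set.Icc 1 2) := by
  intro a ha b hb hab
  have hsqrt : √(2 * b - b ^ 2) < √(2 * a - a ^ 2) :=
    Real.sqrt_lt_sqrt (by nlinarith [hb.1, hb.2]) (by nlinarith [ha.1, hb.1])
  rw [S_eq ha, S_eq hb]
  gcongr

theorem continuousOn_S : ContinuousOn S (Set.Icc 1 2) :=
  (continuousOn_const.div (by fun_prop) fun t _ ↦ by positivity).congr fun _ ↦ S_eq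

theorem bijOn_S : Set.BijOn S (Set.Icc 1 2) (Set.Icc 1 2) := by
  have hmaps := strictMonoOn_S.monotoneOn.mapsTo_Icc
  have hsurj := continuousOn_S.surjOn_Icc (Set.left_mem_Icc.2 one_le_two)
    (Set.right_mem_Icc.2 one_le_two)
  rw [S_one, S_two] at hmaps hsurj
  exact ⟨hmaps, strictMonoOn_S.injOn, hsurj⟩

theorem one_lt_mul_one_sub_R (h1 : 1 < t) (h2 : t < 2) : 1 < t * (1 - R t) := by
  have hsqrt : 2 - t < √(2 * t - t ^ 2) := Real.lt_sqrt_of_sq_lt (by nlinarith)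
  linarith [mul_R (t := t) (by positivity)]

theorem R_pos (h1 : 1 < t) : 0 < R t := by
  have hsqrt : √(2 * t - t ^ 2) < t := (Real.sqrt_lt' (by positivity)).2 (by nlinarith)
  exact div_pos (sub_pos.2 hsqrt) (by positivity)

/-- The proportion `α = 1 - R t` satisfies the last inequality with equality when `s = S t`. -/
theorem exists_ratio {s : ℝ} (hs : 1 ≤ s) (ht : t ∈ Set.Icc (1 : ℝ) 2) (hst : s < S t) :
    ∃ t' < t, ∃ α, 0 < α ∧ α < 1 ∧ 1 < t' * α ∧ s * α * (1 - t' * (1 - α)) < 2 * α - 1 := by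
  obtain ⟨_, hss', hs't⟩ := exists_between hst
  obtain ⟨t', ht', rfl⟩ := bijOn_S.surjOn
    ⟨hs.trans hss'.le, hs't.le.trans (bijOn_S.mapsTo ht).2⟩
  have htt : t' < t := (strictMonoOn_S.lt_iff_lt ht' ht).1 hs't
  have h1 : 1 < t' := lt_of_le_of_ne ht'.1 fun h ↦ by
    rw [← h, S_one] at hss'
    linarith
  have htα := one_lt_mul_one_sub_R h1 (htt.trans_le ht.2)
  have hα0 : 0 < 1 - R t' := pos_of_mul_pos_right (zero_lt_one.trans htα) (by positivity)
  have hβ0 : 0 < 1 - t' * R t' := by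
    rw [mul_R (by positivity)]
    linarith [Real.sqrt_nonneg (2 * t' - t' ^ 2), ht.2]
  refine ⟨t', htt, 1 - R t', hα0, by linarith [R_pos h1], htα, ?_⟩
  calc s * (1 - R t') * (1 - t' * (1 - (1 - R t'))) = s * ((1 - R t') * (1 - t' * R t')) := by ring
    _ < S t' * ((1 - R t') * (1 - t' * R t')) := by gcongr
    _ = 2 * (1 - R t') - 1 := by rw [S_mul_one_sub_R_mul_one_sub_mul_R ht']; ring

end ExtremalFunction

section Exponents

variable {m n : ℕ} {ξ s t : ℝ}

theorem le_mul_hatLambda (hn : n ≠ 0) (h : ∀ᶠ X : ℝ in atTop, SimulSolvable n ξ (t / n) X) :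
    (t : EReal) ≤ n * hatLambda n ξ := by
  have hle : ((t / n : ℝ) : EReal) ≤ hatLambda n ξ := le_sSup (Set.mem_image_of_mem _ h)
  calc (t : EReal) = n * ((t / n : ℝ) : EReal) := by
        rw [← EReal.coe_natCast, ← EReal.coe_mul, mul_div_cancel₀ _ (Nat.cast_ne_zero.2 hn)]
    _ ≤ n * hatLambda n ξ := by gcongr

theorem hatLambda_le (h : ¬∀ᶠ X : ℝ in atTop, SimulSolvable n ξ t X) : hatLambda n ξ ≤ t := by
  refine sSup_le ?_
  rintro _ ⟨lam, hlam, rfl⟩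
  refine EReal.coe_le_coe_iff.2 (le_of_not_gt fun hlt ↦ h ?_)
  filter_upwards [hlam, eventually_ge_atTop 1] with X hX hX1
  exact hX.mono hX1 hlt.le

theorem eventually_simulSolvable_of_lt_mul_hatLambda (hn : n ≠ 0)
    (h : (t : EReal) < n * hatLambda n ξ) :
    ∀ᶠ X : ℝ in atTop, SimulSolvable n ξ (t / n) X := by
  contrapose h
  rw [not_lt]
  calc n * hatLambda n ξ ≤ n * ((t / n : ℝ) : EReal) := by
        gcongr
        exact hatLambda_le h
    _ = t := by
      rw [← EReal.coe_natCast, ← EReal.coe_mul, mul_div_cancel₀ _ (Nat.cast_ne_zero.2 hn)]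

theorem le_hatW_div (hm : m ≠ 0) (h : ∀ᶠ X : ℝ in atTop, LinFormSolvable m ξ (s * m) X) :
    (s : EReal) ≤ hatW m ξ / m := by
  rw [EReal.le_div_iff_mul_le (Nat.cast_pos'.2 (Nat.pos_of_ne_zero hm)) (EReal.natCast_ne_top m),
    ← EReal.coe_natCast, ← EReal.coe_mul]
  exact le_sSup (Set.mem_image_of_mem _ h)

theorem one_le_mul_hatLambda (hn : n ≠ 0) (ξ : ℝ) : 1 ≤ (n : EReal) * hatLambda n ξ := by
  have hn0 : (0 : ℝ) < n := Nat.cast_pos.2 (Nat.pos_of_ne_zero hn)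
  refine EReal.ge_of_forall_gt_iff_ge.1 fun b hb ↦ ?_
  rw [← EReal.coe_one, EReal.coe_lt_coe_iff] at hb
  refine (EReal.coe_le_coe_iff.2 (le_max_left b 0)).trans (le_mul_hatLambda hn ?_)
  exact eventually_simulSolvable_of_lt ξ (by positivity)
    (by rw [div_mul_cancel₀ _ hn0.ne']; exact max_lt hb one_pos)

theorem one_le_hatW_div (hm : m ≠ 0) (ξ : ℝ) : 1 ≤ hatW m ξ / m := by
  have hm0 : (0 : ℝ) < m := Nat.cast_pos.2 (Nat.pos_of_ne_zero hm)
  refine EReal.ge_of_forall_gt_iff_ge.1 fun b hb ↦ ?_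
  rw [← EReal.coe_one, EReal.coe_lt_coe_iff] at hb
  refine (EReal.coe_le_coe_iff.2 (le_max_left b 0)).trans (le_hatW_div hm ?_)
  exact eventually_linFormSolvable_of_lt ξ (by positivity)
    (mul_lt_of_lt_one_left hm0 (max_lt hb one_pos))

theorem mul_hatLambda_le (hξ : Transcendental ℚ ξ) (hn : 2 ≤ n) :
    n * hatLambda n ξ ≤ ((2 * (n / (n - 1)) : ℝ) : EReal) := by
  have hn1 : (0 : ℝ) < n - 1 := sub_pos.2 (Nat.one_lt_cast.2 hn)
  have hle : hatLambda n ξ ≤ ((2 / (n - 1) : ℝ) : EReal) := by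
    refine sSup_le ?_
    rintro _ ⟨lam, hlam, rfl⟩
    rw [EReal.coe_le_coe_iff, le_div_iff₀ hn1]
    have hsplit : n / 2 + (n - n / 2) = n := by omega
    have hDS : lam * (n / 2 : ℕ) ≤ 1 :=
      lam_mul_le_one hξ (by omega : n / 2 ≤ n - n / 2) (by rwa [hsplit])
    have hhalf : (n : ℝ) ≤ 2 * (n / 2 : ℕ) + 1 := by
      exact_mod_cast (by omega : n ≤ 2 * (n / 2) + 1)
    rcases le_or_gt lam 0 with hneg | hpos <;> nlinarith
  calc n * hatLambda n ξ ≤ n * ((2 / (n - 1) : ℝ) : EReal) := by gcongr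
    _ = ((2 * (n / (n - 1)) : ℝ) : EReal) := by
      rw [← EReal.coe_natCast, ← EReal.coe_mul, mul_div_left_comm]

theorem one_le_lowerHatLambda (ξ : ℝ) : 1 ≤ lowerHatLambda ξ :=
  le_liminf_of_le (by isBoundedDefault)
    ((eventually_ne_atTop 0).mono fun _ hn ↦ one_le_mul_hatLambda hn ξ)

theorem one_le_lowerHatW (ξ : ℝ) : 1 ≤ lowerHatW ξ :=
  le_liminf_of_le (by isBoundedDefault)
    ((eventually_ne_atTop 0).mono fun _ hm ↦ one_le_hatW_div hm ξ)

theorem lowerHatLambda_le_upperHatLambda (ξ : ℝ) : lowerHatLambda ξ ≤ upperHatLambda ξ :=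
  liminf_le_limsup

theorem lowerHatW_le_upperHatW (ξ : ℝ) : lowerHatW ξ ≤ upperHatW ξ :=
  liminf_le_limsup

theorem upperHatLambda_le_two (hξ : Transcendental ℚ ξ) : upperHatLambda ξ ≤ (2 : ℝ) := by
  have hlim : Tendsto (fun n : ℕ ↦ 2 * ((n : ℝ) / (n - 1))) atTop (nhds 2) := by
    simpa [sub_eq_add_neg] using (tendsto_natCast_div_add_atTop (-1 : ℝ)).const_mul 2
  rw [← ((continuous_coe_real_ereal.tendsto 2).comp hlim).limsup_eq]
  exact limsup_le_limsup ((eventually_ge_atTop 2).mono fun _ hn ↦ mul_hatLambda_le hξ hn)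

theorem le_hatW_div_of_lt_mul_hatLambda (hξ : Transcendental ℚ ξ) (hmn : m ≤ n) (hs0 : 0 ≤ s)
    (hmain : 1 < t * (m / n : ℝ))
    (hs : s * (m / n : ℝ) * (1 - t * (1 - (m / n : ℝ))) < 2 * (m / n : ℝ) - 1)
    (ht : (t : EReal) < n * hatLambda n ξ) : (s : EReal) ≤ hatW m ξ / m := by
  have hm : m ≠ 0 := fun h ↦ by norm_num [h] at hmain
  have hn0 : (0 : ℝ) < n := Nat.cast_pos.2 ((Nat.pos_of_ne_zero hm).trans_le hmn)
  have hsim := eventually_simulSolvable_of_lt_mul_hatLambda (Nat.cast_ne_zero.1 hn0.ne') ht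
  obtain ⟨r, rfl⟩ := Nat.exists_eq_add_of_le hmn
  refine le_hatW_div hm (eventually_linFormSolvable_of_simulSolvable hξ ?_ (by positivity) ?_ hsim)
  · rwa [div_mul_eq_mul_div, mul_div_assoc]
  · set μ : ℝ := m / (m + r : ℕ) with hμ
    have hnμ : (m + r : ℕ) * μ = m := mul_div_cancel₀ _ hn0.ne'
    calc s * m * (1 - t / (m + r : ℕ) * r)
        = (m + r : ℕ) * (s * μ * (1 - t * (1 - μ))) := by
          rw [hμ]
          push_cast at hn0 ⊢
          field_simp
          ring
      _ < (m + r : ℕ) * (2 * μ - 1) := by gcongr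
      _ = m - r := by push_cast at hnμ ⊢; linear_combination 2 * hnμ
      _ < m - r + (t * μ - 1) := lt_add_of_pos_right _ (sub_pos.2 hmain)
      _ = m - r + t / (m + r : ℕ) * m - 1 := by rw [hμ]; ring

theorem eventually_le_hatW_div {α : ℝ} (hξ : Transcendental ℚ ξ) (hs0 : 0 ≤ s) (htα : 1 < t * α)
    (hs : s * α * (1 - t * (1 - α)) < 2 * α - 1) :
    ∀ᶠ n : ℕ in atTop, ∀ m ≤ n, |m - α * n| ≤ 1 → (t : EReal) < n * hatLambda n ξ →
      (s : EReal) ≤ hatW m ξ / m := by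
  have hnear : ∀ᶠ μ in nhds α, 1 < t * μ ∧ s * μ * (1 - t * (1 - μ)) < 2 * μ - 1 :=
    (ContinuousAt.eventually_lt (by fun_prop) (by fun_prop) htα).and
      (ContinuousAt.eventually_lt (by fun_prop) (by fun_prop) hs)
  obtain ⟨δ, hδ, hball⟩ := Metric.eventually_nhds_iff.1 hnear
  filter_upwards [eventually_gt_atTop 0,
    tendsto_one_div_atTop_nhds_zero_nat.eventually_lt_const hδ] with n hn hnδ m hmn hm ht
  have hn0 : (0 : ℝ) < n := Nat.cast_pos.2 hn
  have hdist : dist (m / n : ℝ) α < δ := by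
    refine lt_of_le_of_lt ?_ hnδ
    rw [Real.dist_eq, div_sub' hn0.ne', abs_div, abs_of_pos hn0, mul_comm]
    gcongr
  exact le_hatW_div_of_lt_mul_hatLambda hξ hmn hs0 (hball hdist).1 (hball hdist).2 ht

theorem coe_S_le {x : EReal} (hx : 1 ≤ x)
    (h : ∀ s, 1 ≤ s → s < S t → (s : EReal) ≤ x) : (S t : EReal) ≤ x := by
  refine EReal.ge_of_forall_gt_iff_ge.1 fun s hs ↦ ?_
  obtain hs1 | hs1 := lt_or_ge s 1
  · exact (EReal.coe_le_coe_iff.2 hs1.le).trans hx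
  · exact h s hs1 (EReal.coe_lt_coe_iff.1 hs)

theorem coe_S_le_upperHatW (hξ : Transcendental ℚ ξ) (ht : t ∈ Set.Icc (1 : ℝ) 2)
    (h : t ≤ upperHatLambda ξ) : S t ≤ upperHatW ξ := by
  refine coe_S_le ((one_le_lowerHatW ξ).trans (lowerHatW_le_upperHatW ξ)) fun s hs1 hs ↦ ?_
  obtain ⟨t', htt, α, hα0, hα1, htα, hsα⟩ := exists_ratio hs1 ht hs
  have hfreq : ∃ᶠ n : ℕ in atTop, (t' : EReal) < n * hatLambda n ξ :=
    frequently_lt_of_lt_limsup (by isBoundedDefault) ((EReal.coe_lt_coe_iff.2 htt).trans_le h)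
  have hceil : Tendsto (fun n : ℕ ↦ ⌈α * n⌉₊) atTop atTop :=
    tendsto_nat_ceil_atTop.comp (tendsto_natCast_atTop_atTop.const_mul_atTop hα0)
  refine le_limsup_of_frequently_le (hceil.frequently ?_) (by isBoundedDefault)
  refine (hfreq.and_eventually (eventually_le_hatW_div hξ (by positivity) htα hsα)).mono ?_
  rintro n ⟨hn, hle⟩
  refine hle _ (Nat.ceil_le.2 (mul_le_of_le_one_left n.cast_nonneg hα1.le)) ?_ hn
  rw [abs_of_nonneg (sub_nonneg.2 (Nat.le_ceil _)), sub_le_iff_le_add']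
  exact (Nat.ceil_lt_add_one (by positivity)).le

theorem coe_S_le_lowerHatW (hξ : Transcendental ℚ ξ) (ht : t ∈ Set.Icc (1 : ℝ) 2)
    (h : t ≤ lowerHatLambda ξ) : S t ≤ lowerHatW ξ := by
  refine coe_S_le (one_le_lowerHatW ξ) fun s hs1 hs ↦ ?_
  obtain ⟨t', htt, α, hα0, hα1, htα, hsα⟩ := exists_ratio hs1 ht hs
  have hev : ∀ᶠ n : ℕ in atTop, (t' : EReal) < n * hatLambda n ξ :=
    eventually_lt_of_lt_liminf ((EReal.coe_lt_coe_iff.2 htt).trans_le h)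
  have hfloor : Tendsto (fun m : ℕ ↦ ⌊m / α⌋₊) atTop atTop :=
    tendsto_nat_floor_atTop.comp (tendsto_natCast_atTop_atTop.atTop_div_const hα0)
  refine le_liminf_of_le (by isBoundedDefault) ?_
  filter_upwards [hfloor.eventually hev,
    hfloor.eventually (eventually_le_hatW_div hξ (by positivity) htα hsα)] with m hm hle
  have hlower : α * ⌊m / α⌋₊ ≤ m := (le_div_iff₀' hα0).1 (Nat.floor_le (by positivity))
  have hupper : m < α * (⌊m / α⌋₊ + 1) := (div_lt_iff₀' hα0).1 (Nat.lt_floor_add_one _)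
  refine hle m (Nat.le_floor (le_div_self m.cast_nonneg hα0 hα1.le)) ?_ hm
  rw [abs_of_nonneg (sub_nonneg.2 hlower)]
  linarith

theorem exists_coe_eq_of_mem_Icc {x : EReal} {a b : ℝ} (hx : x ∈ Set.Icc (a : EReal) b) :
    ∃ t ∈ Set.Icc a b, x = t := by
  lift x to ℝ using ⟨(hx.2.trans_lt (EReal.coe_lt_top b)).ne,
    ((EReal.bot_lt_coe a).trans_le hx.1).ne'⟩
  exact ⟨x, ⟨EReal.coe_le_coe_iff.1 hx.1, EReal.coe_le_coe_iff.1 hx.2⟩, rfl⟩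

end Exponents

end DiophExp

theorem corollary2p3 :
    (∀ ξ : ℝ, Transcendental ℚ ξ →
      (∃ t : ℝ, t ∈ Set.Icc (1 : ℝ) 2 ∧ DiophExp.upperHatLambda ξ = (t : EReal) ∧
        (DiophExp.S t : EReal) ≤ DiophExp.upperHatW ξ) ∧
      (∃ t : ℝ, t ∈ Set.Icc (1 : ℝ) 2 ∧ DiophExp.lowerHatLambda ξ = (t : EReal) ∧
        (DiophExp.S t : EReal) ≤ DiophExp.lowerHatW ξ)) ∧
    StrictMonoOn DiophExp.S (Set.Icc 1 2) ∧
    Set.BijOn DiophExp.S (Set.Icc 1 2) (Set.Icc 1 2) := by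
  refine ⟨fun ξ hξ ↦ ?_, DiophExp.strictMonoOn_S, DiophExp.bijOn_S⟩
  have hlower := DiophExp.one_le_lowerHatLambda ξ
  have hle := DiophExp.lowerHatLambda_le_upperHatLambda ξ
  have hupper := DiophExp.upperHatLambda_le_two hξ
  obtain ⟨t, ht, htξ⟩ := DiophExp.exists_coe_eq_of_mem_Icc ⟨hlower.trans hle, hupper⟩
  obtain ⟨u, hu, huξ⟩ := DiophExp.exists_coe_eq_of_mem_Icc ⟨hlower, hle.trans hupper⟩
  exact ⟨⟨t, ht, htξ, DiophExp.coe_S_le_upperHatW hξ ht htξ.ge⟩,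
    ⟨u, hu, huξ, DiophExp.coe_S_le_lowerHatW hξ hu huξ.ge⟩⟩
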